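/- Let $d\ge 1$ and let $\nu$ be a symmetric probability measure on $\mathbb R$ with compact support, $\nu\neq\delta_0$. Let $\mathbb P$ be the law of the random walk path $x=(x_0,\dots,x_T)$ in $\mathbb R^d$ with $x_0=0$ and i.i.d. increments of law $\nu^{\otimes d}$ (that is, the $d$ coordinates of each increment are i.i.d. with law $\nu$). For $\alpha,\gamma,\xi>0$ and $T\in\mathbb N$ define the probability measure $$\hat{\mathbb P}_{\alpha,T,\gamma,\xi}(\mathrm dx)=\frac1{Z_{\alpha,T,\gamma,\xi}}\exp\Big(\alpha\sum_{0\le i<j\le T}\frac{\|x_j-x_i\|^\gamma}{|j-i|^\xi}\Big)\,\mathbb P(\mathrm dx),$$ where $\|\cdot\|$ is the Euclidean norm and $Z_{\alpha,T,\gamma,\xi}$ is the normalizing constant. Let $\gamma$ be a positive even integer, let $c_{\mathrm{crit}}=\log_2(1+\tanh 2)$, let $c\in(0,c_{\mathrm{crit}})$, and set $\xi=\gamma/2+c$ and $\alpha_*(c)=2^c\,\mathrm{arctanh}(2^c-1)$. Then there is a constant $C>0$, depending only on $d,\nu,\gamma,c$, such that for all $\alpha\ge\alpha_*(c)$ and all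 $T\in\mathbb N$, $$\mathbb E^{\hat{\mathbb P}_{\alpha,T,\gamma,\xi}}\big[\|x_T\|^2\big]\ \ge\ C\,T^{1+\log_2(1+\tanh 2)}.$$ -/

import Mathlib

open MeasureTheory

noncomputable section

/-- The increment law `η = ν ⊗ ⋯ ⊗ ν` on Euclidean space `ℝ^d`: the coordinates of one step are
independent with common law `ν`. -/
def incrementLaw (d : ℕ) (ν : Measure ℝ) : Measure (EuclideanSpace ℝ (Fin d)) :=
  (Measure.pi fun _ : Fin d => ν).map (WithLp.toLp 2)

/-- The path `x_0, …, x_T` with steps `φ_1, …, φ_T` (the step `φ_{k+1}` is `φ k`):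
`x_n = φ_1 + ⋯ + φ_n`, in particular `x_0 = 0`. -/
def walkPath {d T : ℕ} (φ : Fin T → EuclideanSpace ℝ (Fin d)) :
    Fin (T + 1) → EuclideanSpace ℝ (Fin d) :=
  fun n => ∑ k : Fin T with k.val < n.val, φ k

/-- The law of the path `x_0, …, x_T` of the product walk: the steps are i.i.d. with law `η`. -/
def walkLaw (d : ℕ) (ν : Measure ℝ) (T : ℕ) :
    Measure (Fin (T + 1) → EuclideanSpace ℝ (Fin d)) :=
  (Measure.pi fun _ : Fin T => incrementLaw d ν).map walkPath

/-- The pair interaction `∑_{0 ≤ i < j ≤ T} ‖x_j - x_i‖^γ / |j - i|^ξ`. -/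
def longRangeInteraction {d T : ℕ} (γ ξ : ℝ)
    (x : Fin (T + 1) → EuclideanSpace ℝ (Fin d)) : ℝ :=
  ∑ i : Fin (T + 1), ∑ j : Fin (T + 1) with i < j,
    ‖x j - x i‖ ^ γ / |(j.val : ℝ) - (i.val : ℝ)| ^ ξ

/-- The long-range repulsive path measure: the walk law reweighted by
`Z⁻¹ exp (α ∑_{0 ≤ i < j ≤ T} ‖x_j - x_i‖^γ / |j - i|^ξ)`. -/
def repulsiveLaw (d : ℕ) (ν : Measure ℝ) (α : ℝ) (T : ℕ) (γ ξ : ℝ) :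
    Measure (Fin (T + 1) → EuclideanSpace ℝ (Fin d)) :=
  (walkLaw d ν T).tilted fun x => α * longRangeInteraction γ ξ x

/-- The critical exponent `c_crit = log₂ (1 + tanh 2)`. -/
def cCrit : ℝ := Real.logb 2 (1 + Real.tanh 2)

/-- The threshold `α_*(c) = 2^c arctanh (2^c - 1)`. -/
def alphaStar (c : ℝ) : ℝ := (2 : ℝ) ^ c * Real.artanh ((2 : ℝ) ^ c - 1)

end

/-! The walk is in fact ballistic, so the stated exponent is not sharp. Let `M` be the essential
supremum of `|s|` under `ν`, and `R = √d * M` the maximal speed. Since `c < cCrit ≤ 1` and `2 ≤ γ`,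
one has `ξ ≤ γ`, so a straight path at speed `R` has energy of order `T ^ (2 + γ - ξ)`, at least of
order `T ^ 2`. A path ending within `R * T / 4` of the origin loses a fixed multiple of this order
(`le_straightEnergy_sub`). A nearly straight path loses at most half as much
(`straightEnergy_sub_le`), and such paths have probability at least `p ^ T`
(`pow_le_walkLaw_straight`).

The energy gain, quadratic in `T`, beats the entropy cost, linear in `T`, uniformly for `α` bounded
below. `div_one_add_le_integral_tilted` turns this into a second moment of order `T ^ 2`, and `1 +
cCrit ≤ 2` finishes. -/

open Real Finset

/-! ### Energy against entropy for tilted measures -/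

/-- Energy-entropy lower bound for the mean of `g` under a tilted measure: a set `G` of mass at
least `q` on which `f` is larger by `b` than on `{g < r}` forces `{r ≤ g}` to be charged. -/
theorem div_one_add_le_integral_tilted {X : Type*} [MeasurableSpace X] {μ : Measure X}
    [IsProbabilityMeasure μ] {f g : X → ℝ} (hf : Integrable (fun x => exp (f x)) μ)
    (hfg : Integrable (fun x => exp (f x) * g x) μ) (hg : ∀ x, 0 ≤ g x) {r h b K q : ℝ}
    (hr : 0 ≤ r) (hK : 0 ≤ K) {G : Set X} (hGm : MeasurableSet G) (hq : q ≤ μ.real G)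
    (hB : ∀ᵐ x ∂μ, g x < r → f x ≤ h - 2 * b)
    (hG : ∀ᵐ x ∂μ, x ∈ G → r ≤ g x ∧ h - b ≤ f x) (hbK : exp (-b) ≤ K * q) :
    r / (1 + K) ≤ ∫ x, g x ∂(μ.tilted f) := by
  set Z := ∫ x, exp (f x) ∂μ with hZ
  set N := ∫ x, exp (f x) * g x ∂μ with hN
  have hZ0 : 0 < Z := integral_exp_pos hf
  have hint : ∫ x, g x ∂(μ.tilted f) = N / Z := by
    rw [integral_tilted, hN, ← integral_div]
    exact integral_congr_ae (.of_forall fun x => by simp only [smul_eq_mul]; ring)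
  -- Split at `g < r`: where `r ≤ g` the integrand is absorbed by `N`, elsewhere `exp (f x)` is at
  -- most `exp (h - 2 * b)`.
  have h1 : r * Z ≤ N + r * exp (h - 2 * b) := by
    calc r * Z = ∫ x, r * exp (f x) ∂μ := (integral_const_mul _ _).symm
      _ ≤ ∫ x, (exp (f x) * g x + r * exp (h - 2 * b)) ∂μ := by
        refine integral_mono_ae (hf.const_mul r) (hfg.add (integrable_const _)) ?_
        filter_upwards [hB] with x hx
        rcases lt_or_ge (g x) r with hlt | hge
        · have := mul_le_mul_of_nonneg_left (exp_le_exp.2 (hx hlt)) hr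
          have := mul_nonneg (exp_pos (f x)).le (hg x)
          linarith
        · have := mul_le_mul_of_nonneg_left hge (exp_pos (f x)).le
          have := mul_nonneg hr (exp_pos (h - 2 * b)).le
          linarith
      _ = N + r * exp (h - 2 * b) := by
        rw [integral_add hfg (integrable_const _)]
        simp [hN]
  have h2 : q * (r * exp (h - b)) ≤ N := by
    calc q * (r * exp (h - b)) ≤ μ.real G * (r * exp (h - b)) := by gcongr
      _ = ∫ x, G.indicator (fun _ => r * exp (h - b)) x ∂μ := by
        rw [integral_indicator hGm, setIntegral_const, smul_eq_mul]
      _ ≤ N := by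
        refine integral_mono_ae ((integrable_const _).indicator hGm) hfg ?_
        filter_upwards [hG] with x hx
        by_cases hxG : x ∈ G
        · rw [Set.indicator_of_mem hxG, mul_comm (exp _)]
          exact mul_le_mul (hx hxG).1 (exp_le_exp.2 (hx hxG).2) (exp_pos _).le (hg x)
        · rw [Set.indicator_of_notMem hxG]
          exact mul_nonneg (exp_pos _).le (hg x)
  have h3 : r * exp (h - 2 * b) ≤ K * N := by
    calc r * exp (h - 2 * b) = exp (-b) * (r * exp (h - b)) := by
          rw [show h - 2 * b = -b + (h - b) by ring, exp_add]; ring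
      _ ≤ K * q * (r * exp (h - b)) := by gcongr
      _ = K * (q * (r * exp (h - b))) := by ring
      _ ≤ K * N := by gcongr
  rw [hint, div_le_div_iff₀ (by positivity) hZ0]
  linarith

/-! ### Deterministic energy estimates -/

theorem le_card_filter_eight_mul_le (T : ℕ) :
    (T : ℝ) / 8 ≤ #{i : Fin (T + 1) | 8 * i.val ≤ T} := by
  have h : T / 8 + 1 ≤ #{i : Fin (T + 1) | 8 * i.val ≤ T} := by
    rw [← Finset.card_range (T / 8 + 1)]
    refine Finset.card_le_card_of_injOn (fun n => Fin.ofNat (T + 1) n) ?_ ?_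
    · intro n hn
      simp only [coe_range, Set.mem_Iio] at hn
      simp only [coe_filter, mem_univ, true_and, Set.mem_ofPred_eq, Fin.val_ofNat]
      rw [Nat.mod_eq_of_lt (by omega)]
      omega
    · intro n hn m hm hnm
      simp only [coe_range, Set.mem_Iio] at hn hm
      have := congrArg Fin.val hnm
      simp only [Fin.val_ofNat] at this
      rwa [Nat.mod_eq_of_lt (by omega), Nat.mod_eq_of_lt (by omega)] at this
  have h' : T ≤ 8 * #{i : Fin (T + 1) | 8 * i.val ≤ T} := by omega
  have : (T : ℝ) ≤ 8 * (#{i : Fin (T + 1) | 8 * i.val ≤ T} : ℝ) := by exact_mod_cast h'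
  linarith

theorem le_card_filter_eight_mul_sub_le (T : ℕ) :
    (T : ℝ) / 8 ≤ #{j : Fin (T + 1) | 8 * (T - j.val) ≤ T} := by
  refine (le_card_filter_eight_mul_le T).trans_eq ?_
  congr 1
  refine Finset.card_bij (fun i _ => Fin.rev i) ?_ (fun _ _ _ _ h => Fin.rev_injective h) ?_
  · intro i hi
    simp only [mem_filter, mem_univ, true_and, Fin.val_rev] at hi ⊢
    omega
  · intro j hj
    refine ⟨Fin.rev j, ?_, Fin.rev_rev j⟩
    simp only [mem_filter, mem_univ, true_and, Fin.val_rev] at hj ⊢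
    omega

/-- The energy of a path moving in a straight line at speed `R`. -/
noncomputable def straightEnergy (T : ℕ) (γ ξ R : ℝ) : ℝ :=
  ∑ i : Fin (T + 1), ∑ j : Fin (T + 1) with i < j,
    R ^ γ * ((j.val : ℝ) - (i.val : ℝ)) ^ (γ - ξ)

theorem mul_rpow_div_rpow {ρ n : ℝ} (hρ : 0 ≤ ρ) (hn : 0 < n) (γ ξ : ℝ) :
    (ρ * n) ^ γ / |n| ^ ξ = ρ ^ γ * n ^ (γ - ξ) := by
  rw [abs_of_pos hn, mul_rpow hρ hn.le, rpow_sub hn, mul_div_assoc]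

theorem Fin.val_sub_pos {n : ℕ} {i j : Fin n} (h : i < j) : 0 < (j.val : ℝ) - i.val :=
  sub_pos.2 (Nat.cast_lt.2 h)

section Deterministic

variable {d T : ℕ} {γ ξ R : ℝ} {x : Fin (T + 1) → EuclideanSpace ℝ (Fin d)}

/-- A path with increments `≥ (1 - ε) R` loses at most a fraction `γ ε` of the straight energy. -/
theorem straightEnergy_sub_le (hγ : 1 ≤ γ) (hβ : 0 ≤ γ - ξ) (hR : 0 ≤ R) {ε : ℝ} (hε : 0 ≤ ε)
    (hε1 : ε ≤ 1) (hT : 1 ≤ T)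
    (hx : ∀ i j, i < j → (1 - ε) * R * ((j.val : ℝ) - i.val) ≤ ‖x j - x i‖) :
    straightEnergy T γ ξ R - γ * ε * 4 * (R ^ γ * (T : ℝ) ^ (2 + (γ - ξ)))
      ≤ longRangeInteraction γ ξ x := by
  have hT' : (1 : ℝ) ≤ T := by exact_mod_cast hT
  have key : ∀ i j : Fin (T + 1), i < j →
      R ^ γ * ((j.val : ℝ) - i.val) ^ (γ - ξ) - γ * ε * (R ^ γ * (T : ℝ) ^ (γ - ξ)) ≤
        ‖x j - x i‖ ^ γ / |(j.val : ℝ) - (i.val : ℝ)| ^ ξ := by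
    intro i j hij
    have hn := Fin.val_sub_pos hij
    set n := (j.val : ℝ) - i.val with hn_def
    have hnT : n ≤ T := by
      have : (j.val : ℝ) ≤ T := by exact_mod_cast Nat.lt_succ_iff.1 j.2
      have : (0 : ℝ) ≤ i.val := by positivity
      linarith
    calc R ^ γ * n ^ (γ - ξ) - γ * ε * (R ^ γ * (T : ℝ) ^ (γ - ξ))
        ≤ R ^ γ * n ^ (γ - ξ) - γ * ε * (R ^ γ * n ^ (γ - ξ)) := by gcongr
      _ = (1 + γ * -ε) * (R ^ γ * n ^ (γ - ξ)) := by ring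
      -- Bernoulli's inequality, the reason for `1 ≤ γ`.
      _ ≤ (1 + -ε) ^ γ * (R ^ γ * n ^ (γ - ξ)) := by
        gcongr
        exact one_add_mul_self_le_rpow_one_add (by linarith) hγ
      _ = ((1 - ε) * R * n) ^ γ / |n| ^ ξ := by
        rw [mul_rpow_div_rpow (mul_nonneg (by linarith) hR) hn, mul_rpow (by linarith) hR,
          ← sub_eq_add_neg, mul_assoc]
      _ ≤ ‖x j - x i‖ ^ γ / |n| ^ ξ := by
        have : 0 ≤ (1 - ε) * R * n := mul_nonneg (mul_nonneg (by linarith) hR) hn.le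
        gcongr
        exact hx i j hij
  have hδ : 0 ≤ γ * ε * (R ^ γ * (T : ℝ) ^ (γ - ξ)) := by positivity
  have hsum : straightEnergy T γ ξ R -
      ∑ i : Fin (T + 1), ∑ j : Fin (T + 1) with i < j, γ * ε * (R ^ γ * (T : ℝ) ^ (γ - ξ))
      ≤ longRangeInteraction γ ξ x := by
    rw [straightEnergy, longRangeInteraction, ← Finset.sum_sub_distrib]
    refine Finset.sum_le_sum fun i _ => ?_
    rw [← Finset.sum_sub_distrib]
    exact Finset.sum_le_sum fun j hj => key i j (by simpa using hj)
  have hcount : ∑ i : Fin (T + 1), ∑ j : Fin (T + 1) with i < j,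
      γ * ε * (R ^ γ * (T : ℝ) ^ (γ - ξ)) ≤
      γ * ε * 4 * (R ^ γ * (T : ℝ) ^ (2 + (γ - ξ))) := by
    calc _ ≤ ∑ i : Fin (T + 1), ∑ j : Fin (T + 1), γ * ε * (R ^ γ * (T : ℝ) ^ (γ - ξ)) :=
          Finset.sum_le_sum fun i _ =>
            Finset.sum_le_sum_of_subset_of_nonneg (Finset.filter_subset _ _) fun _ _ _ => hδ
      _ = ((T : ℝ) + 1) * ((T + 1) * (γ * ε * (R ^ γ * (T : ℝ) ^ (γ - ξ)))) := by
        simp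
      _ ≤ ((T : ℝ) + T) * ((T + T) * (γ * ε * (R ^ γ * (T : ℝ) ^ (γ - ξ)))) := by gcongr
      _ = _ := by
        rw [rpow_add (by linarith), rpow_two]; ring
  linarith

/-- A path with increments `≤ R` whose endpoint is at distance `< R T / 4` loses a positive
fraction of the straight energy. -/
theorem le_straightEnergy_sub (hγ : 1 ≤ γ) (hβ : 0 ≤ γ - ξ) (hR : 0 ≤ R) (hT : 1 ≤ T)
    (hx : ∀ i j, i ≤ j → ‖x j - x i‖ ≤ R * ((j.val : ℝ) - i.val)) (hx0 : x 0 = 0)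
    (hxT : ‖x (Fin.last T)‖ < R * T / 4) :
    longRangeInteraction γ ξ x ≤ straightEnergy T γ ξ R -
      1 / 3 * (1 / 8 * (1 / 8)) * (3 / 4) ^ (γ - ξ) * (R ^ γ * (T : ℝ) ^ (2 + (γ - ξ))) := by
  have hT' : (1 : ℝ) ≤ T := by exact_mod_cast hT
  set A : Finset (Fin (T + 1)) := {i : Fin (T + 1) | 8 * i.val ≤ T} with hA
  set B : Finset (Fin (T + 1)) := {j : Fin (T + 1) | 8 * (T - j.val) ≤ T} with hB
  set δ : ℝ := 1 / 3 * (3 / 4) ^ (γ - ξ) * (R ^ γ * (T : ℝ) ^ (γ - ξ)) with hδ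
  have hδ0 : 0 ≤ δ := by positivity
  have hgap : ∀ i j : Fin (T + 1), i < j →
      ‖x j - x i‖ ^ γ / |(j.val : ℝ) - (i.val : ℝ)| ^ ξ ≤
        R ^ γ * ((j.val : ℝ) - i.val) ^ (γ - ξ) := by
    intro i j hij
    have hn := Fin.val_sub_pos hij
    rw [← mul_rpow_div_rpow hR hn]
    gcongr
    exact hx i j hij.le
  have hfar : ∀ i ∈ A, ∀ j ∈ B, i < j ∧
      δ ≤ R ^ γ * ((j.val : ℝ) - i.val) ^ (γ - ξ) -
        ‖x j - x i‖ ^ γ / |(j.val : ℝ) - (i.val : ℝ)| ^ ξ := by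
    intro i hi j hj
    simp only [hA, hB, mem_filter, mem_univ, true_and] at hi hj
    have hjT : j.val ≤ T := Nat.lt_succ_iff.1 j.2
    have hij : i < j := by rw [Fin.lt_def]; omega
    refine ⟨hij, ?_⟩
    have hn := Fin.val_sub_pos hij
    have hi' : 8 * (i.val : ℝ) ≤ T := by exact_mod_cast hi
    have hj' : 8 * ((T : ℝ) - j.val) ≤ T := by
      rw [← Nat.cast_sub hjT]; exact_mod_cast hj
    have hlast := hx j (Fin.last T) (Fin.le_last j)
    have hfirst := hx 0 i (Fin.zero_le i)
    simp only [hx0, sub_zero, Fin.val_last, Fin.val_zero, Nat.cast_zero] at hlast hfirst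
    -- With `n = j - i`, the triangle inequality gives at most `R * (T / 4 + (T - j) + i) = R * (5 *
    -- T / 4 - n)`, and `n ≥ 3 * T / 4` makes this at most `2 / 3 * R * n`.
    have hclose : ‖x j - x i‖ ≤ 2 / 3 * R * ((j.val : ℝ) - i.val) := by
      have htri : ‖x j - x i‖ ≤ ‖x (Fin.last T)‖ + ‖x (Fin.last T) - x j‖ + ‖x i‖ := by
        rw [show x j - x i = x (Fin.last T) - (x (Fin.last T) - x j) - x i by abel]
        exact (norm_sub_le _ _).trans (by gcongr; exact norm_sub_le _ _)
      nlinarith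
    set n := (j.val : ℝ) - i.val with hn_def
    have h23 : (2 / 3 : ℝ) ^ γ ≤ 2 / 3 := by
      simpa using rpow_le_rpow_of_exponent_ge (by norm_num : (0 : ℝ) < 2 / 3) (by norm_num) hγ
    have h1 : ‖x j - x i‖ ^ γ / |n| ^ ξ ≤ 2 / 3 * (R ^ γ * n ^ (γ - ξ)) := by
      calc ‖x j - x i‖ ^ γ / |n| ^ ξ ≤ (2 / 3 * R * n) ^ γ / |n| ^ ξ := by gcongr
        _ = (2 / 3 : ℝ) ^ γ * (R ^ γ * n ^ (γ - ξ)) := by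
          rw [mul_rpow_div_rpow (by positivity) hn, mul_rpow (by norm_num) hR, mul_assoc]
        _ ≤ _ := by gcongr
    have h2 : (3 / 4 : ℝ) ^ (γ - ξ) * (T : ℝ) ^ (γ - ξ) ≤ n ^ (γ - ξ) := by
      rw [← mul_rpow (by norm_num) (by positivity)]
      exact rpow_le_rpow (by positivity) (by linarith) hβ
    have h3 : R ^ γ * ((3 / 4 : ℝ) ^ (γ - ξ) * (T : ℝ) ^ (γ - ξ)) ≤ R ^ γ * n ^ (γ - ξ) := by
      gcongr
    have h4 : δ = 1 / 3 * (R ^ γ * ((3 / 4 : ℝ) ^ (γ - ξ) * (T : ℝ) ^ (γ - ξ))) := by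
      rw [hδ]; ring
    linarith
  -- No pair has negative deficit by `hgap`, so only pairs in `A × B` need be kept.
  have hsum : (#A : ℝ) * (#B * δ) ≤ straightEnergy T γ ξ R - longRangeInteraction γ ξ x := by
    rw [straightEnergy, longRangeInteraction, ← Finset.sum_sub_distrib]
    simp_rw [← Finset.sum_sub_distrib]
    calc (#A : ℝ) * (#B * δ) = ∑ i ∈ A, ∑ j ∈ B, δ := by simp
      _ ≤ ∑ i ∈ A, ∑ j : Fin (T + 1) with i < j, (R ^ γ * ((j.val : ℝ) - i.val) ^ (γ - ξ) -
            ‖x j - x i‖ ^ γ / |(j.val : ℝ) - (i.val : ℝ)| ^ ξ) := by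
        refine Finset.sum_le_sum fun i hi => ?_
        refine (Finset.sum_le_sum fun j hj => (hfar i hi j hj).2).trans ?_
        refine Finset.sum_le_sum_of_subset_of_nonneg ?_ ?_
        · intro j hj
          simpa using (hfar i hi j hj).1
        · intro j hj _
          exact sub_nonneg.2 (hgap i j (by simpa using hj))
      _ ≤ _ := by
        refine Finset.sum_le_sum_of_subset_of_nonneg (Finset.subset_univ _) fun i _ _ => ?_
        exact Finset.sum_nonneg fun j hj => sub_nonneg.2 (hgap i j (by simpa using hj))
  have hcount : (T : ℝ) / 8 * (T / 8 * δ) ≤ #A * (#B * δ) := by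
    have := le_card_filter_eight_mul_le T
    have := le_card_filter_eight_mul_sub_le T
    gcongr
  have hfin : (T : ℝ) / 8 * (T / 8 * δ) =
      1 / 3 * (1 / 8 * (1 / 8)) * (3 / 4) ^ (γ - ξ) * (R ^ γ * (T : ℝ) ^ (2 + (γ - ξ))) := by
    rw [hδ, rpow_add (by linarith : (0 : ℝ) < T), rpow_two]; ring
  linarith

theorem longRangeInteraction_le_straightEnergy (hγ : 0 ≤ γ) (hR : 0 ≤ R)
    (hx : ∀ i j, i ≤ j → ‖x j - x i‖ ≤ R * ((j.val : ℝ) - i.val)) :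
    longRangeInteraction γ ξ x ≤ straightEnergy T γ ξ R := by
  refine Finset.sum_le_sum fun i _ => Finset.sum_le_sum fun j hj => ?_
  have hij : i < j := by simpa using hj
  have hn := Fin.val_sub_pos hij
  rw [← mul_rpow_div_rpow hR hn]
  gcongr
  exact hx i j hij.le

end Deterministic

/-! ### The extreme step size -/

/-- A point of the compact support with largest absolute value gives `M`; symmetry moves its mass to
the positive side if it is negative. -/
theorem exists_essSup_abs_of_symmetric {ν : Measure ℝ} [IsProbabilityMeasure ν]
    (hsymm : ν.map (fun s : ℝ => -s) = ν) (hcompact : IsCompact ν.support)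
    (hnontrivial : ν ≠ Measure.dirac 0) :
    ∃ M : ℝ, 0 < M ∧ (∀ᵐ s ∂ν, |s| ≤ M) ∧ ∀ m < M, 0 < ν (Set.Ici m) := by
  obtain ⟨s₀, hs₀, hmax⟩ := hcompact.exists_isMaxOn
    (Measure.nonempty_support (IsProbabilityMeasure.ne_zero ν)) continuous_abs.continuousOn
  have hae : ∀ᵐ s ∂ν, |s| ≤ |s₀| := by
    filter_upwards [Measure.support_mem_ae (μ := ν)] with s hs using hmax hs
  refine ⟨|s₀|, ?_, hae, fun m hm => ?_⟩
  · by_contra hM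
    have hM0 : |s₀| ≤ 0 := not_lt.1 hM
    have h0 : (fun s : ℝ => s) =ᵐ[ν] fun _ => (0 : ℝ) := by
      filter_upwards [hae] with s hs using abs_nonpos_iff.1 (hs.trans hM0)
    refine hnontrivial ?_
    calc ν = ν.map (fun s => s) := Measure.map_id.symm
      _ = ν.map (fun _ => (0 : ℝ)) := Measure.map_congr h0
      _ = Measure.dirac 0 := by simp
  · have hpos := fun U hU => (Measure.mem_support_iff_forall s₀).1 hs₀ U hU
    rcases abs_cases s₀ with h | h
    · exact hpos _ (Ici_mem_nhds (h.1 ▸ hm))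
    · have hneg : ν (Set.Ici m) = ν (Set.Iic (-m)) := by
        conv_lhs => rw [← hsymm]
        rw [Measure.map_apply measurable_neg measurableSet_Ici]
        congr 1
        ext s
        simp only [Set.mem_preimage, Set.mem_Ici, Set.mem_Iic]
        constructor <;> intro <;> linarith
      rw [hneg]
      exact hpos _ (Iic_mem_nhds (by linarith [h.1]))

/-! ### Speed bounds for paths -/

section Path

variable {d T : ℕ} {φ : Fin T → EuclideanSpace ℝ (Fin d)}

theorem norm_le_sqrt_mul_of_forall_abs_le {M : ℝ} (hM : 0 ≤ M) {v : EuclideanSpace ℝ (Fin d)}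
    (hv : ∀ i, |v i| ≤ M) : ‖v‖ ≤ √d * M := by
  rw [EuclideanSpace.norm_eq, ← sqrt_sq hM, ← sqrt_mul (by positivity)]
  refine sqrt_le_sqrt ((Finset.sum_le_sum fun i _ => pow_le_pow_left₀ (norm_nonneg _) (hv i) 2).trans
    ?_)
  simp

theorem sqrt_mul_le_norm_of_forall_le {m : ℝ} (hm : 0 ≤ m) {v : EuclideanSpace ℝ (Fin d)}
    (hv : ∀ i, m ≤ v i) : √d * m ≤ ‖v‖ := by
  rw [EuclideanSpace.norm_eq, ← sqrt_sq hm, ← sqrt_mul (by positivity)]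
  refine sqrt_le_sqrt (le_trans ?_ (Finset.sum_le_sum fun i _ =>
    pow_le_pow_left₀ hm ((hv i).trans (le_abs_self _)) 2))
  simp

theorem walkPath_zero : walkPath φ 0 = 0 := by
  simp [walkPath]

theorem walkPath_sub_walkPath {i j : Fin (T + 1)} (hij : i ≤ j) :
    walkPath φ j - walkPath φ i = ∑ k : Fin T with i.val ≤ k.val ∧ k.val < j.val, φ k := by
  rw [sub_eq_iff_eq_add, walkPath, walkPath, ← Finset.sum_union]
  · congr 1
    ext k
    have : i.val ≤ j.val := hij
    simp only [mem_filter, mem_univ, true_and, mem_union]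
    omega
  · rw [Finset.disjoint_filter]
    intro k _ h
    omega

theorem card_filter_le_lt {i j : Fin (T + 1)} (hij : i ≤ j) :
    (#{k : Fin T | i.val ≤ k.val ∧ k.val < j.val} : ℝ) = (j.val : ℝ) - i.val := by
  have hij' : i.val ≤ j.val := hij
  rw [← Nat.cast_sub hij', ← Nat.card_Ico]
  congr 1
  refine Finset.card_bij (fun k _ => k.val) ?_ (fun _ _ _ _ h => Fin.ext h) ?_
  · intro k hk
    simpa using hk
  · intro n hn
    rw [Finset.mem_Ico] at hn
    exact ⟨⟨n, by omega⟩, by simpa using hn, rfl⟩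

theorem norm_walkPath_sub_le {M : ℝ} (hM : 0 ≤ M) (hφ : ∀ k l, |φ k l| ≤ M) {i j : Fin (T + 1)}
    (hij : i ≤ j) : ‖walkPath φ j - walkPath φ i‖ ≤ √d * M * ((j.val : ℝ) - i.val) := by
  rw [walkPath_sub_walkPath hij, ← card_filter_le_lt hij]
  refine (norm_sum_le_of_le _ fun k _ =>
    norm_le_sqrt_mul_of_forall_abs_le hM (hφ k)).trans_eq ?_
  simp [mul_comm]

theorem le_norm_walkPath_sub {m : ℝ} (hm : 0 ≤ m) (hφ : ∀ k l, m ≤ φ k l) {i j : Fin (T + 1)}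
    (hij : i ≤ j) : √d * m * ((j.val : ℝ) - i.val) ≤ ‖walkPath φ j - walkPath φ i‖ := by
  rw [walkPath_sub_walkPath hij, ← card_filter_le_lt hij, mul_assoc]
  refine sqrt_mul_le_norm_of_forall_le (by positivity) fun l => ?_
  rw [WithLp.ofLp_sum, Finset.sum_apply, mul_comm, ← nsmul_eq_mul]
  exact Finset.card_nsmul_le_sum _ _ _ fun k _ => hφ k l

end Path

theorem measurable_walkPath {d T : ℕ} :
    Measurable (walkPath : (Fin T → EuclideanSpace ℝ (Fin d)) → _) := by
  unfold walkPath
  fun_prop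

theorem measurable_longRangeInteraction {d T : ℕ} (γ ξ : ℝ) :
    Measurable (longRangeInteraction γ ξ : (Fin (T + 1) → EuclideanSpace ℝ (Fin d)) → ℝ) := by
  unfold longRangeInteraction
  fun_prop

/-! ### Almost sure speed bound and the cost of going straight -/

section Law

variable {d T : ℕ} {ν : Measure ℝ} [IsProbabilityMeasure ν]

instance isProbabilityMeasure_incrementLaw : IsProbabilityMeasure (incrementLaw d ν) :=
  Measure.isProbabilityMeasure_map (by fun_prop)

instance isProbabilityMeasure_walkLaw : IsProbabilityMeasure (walkLaw d ν T) :=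
  Measure.isProbabilityMeasure_map measurable_walkPath.aemeasurable

theorem ae_walkLaw_norm_sub_le {M : ℝ} (hM : 0 ≤ M) (hν : ∀ᵐ s ∂ν, |s| ≤ M) :
    ∀ᵐ x ∂(walkLaw d ν T), x 0 = 0 ∧
      ∀ i j, i ≤ j → ‖x j - x i‖ ≤ √d * M * ((j.val : ℝ) - i.val) := by
  have h1 : ∀ᵐ v ∂(incrementLaw d ν), ∀ l, |v l| ≤ M := by
    have hm : MeasurableSet {v : EuclideanSpace ℝ (Fin d) | ∀ l, |v l| ≤ M} := by
      simp only [Set.ofPred_forall]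
      exact .iInter fun l => measurableSet_le (by fun_prop) measurable_const
    rw [incrementLaw, ae_map_iff (by fun_prop) hm]
    exact ae_all_iff.2 fun l =>
      (Measure.tendsto_eval_ae_ae (μ := fun _ : Fin d => ν) (i := l)).eventually hν
  have h2 : ∀ᵐ φ ∂(Measure.pi fun _ : Fin T => incrementLaw d ν), ∀ k l, |φ k l| ≤ M :=
    ae_all_iff.2 fun k =>
      (Measure.tendsto_eval_ae_ae (μ := fun _ : Fin T => incrementLaw d ν) (i := k)).eventually h1
  have hm : MeasurableSet {x : Fin (T + 1) → EuclideanSpace ℝ (Fin d) | x 0 = 0 ∧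
      ∀ i j, i ≤ j → ‖x j - x i‖ ≤ √d * M * ((j.val : ℝ) - i.val)} := by
    have h : MeasurableSet {x : Fin (T + 1) → EuclideanSpace ℝ (Fin d) |
        ∀ i j, i ≤ j → ‖x j - x i‖ ≤ √d * M * ((j.val : ℝ) - i.val)} := by
      simp only [Set.ofPred_forall]
      exact .iInter fun i => .iInter fun j => .iInter fun _ =>
        measurableSet_le (by fun_prop) measurable_const
    exact (measurableSet_eq_fun (measurable_pi_apply 0) measurable_const).inter h
  rw [walkLaw, ae_map_iff measurable_walkPath.aemeasurable hm]
  filter_upwards [h2] with φ hφ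
  exact ⟨walkPath_zero, fun i j hij => norm_walkPath_sub_le hM hφ hij⟩

theorem measurableSet_le_norm_sub (a : ℝ) :
    MeasurableSet {x : Fin (T + 1) → EuclideanSpace ℝ (Fin d) |
      ∀ i j, i ≤ j → a * ((j.val : ℝ) - i.val) ≤ ‖x j - x i‖} := by
  simp only [Set.ofPred_forall]
  exact .iInter fun i => .iInter fun j => .iInter fun _ =>
    measurableSet_le measurable_const (by fun_prop)

/-- If all `d * T` step coordinates are at least `m`, nothing cancels; independence gives the
probability. -/
theorem pow_le_walkLaw_straight {m : ℝ} (hm : 0 ≤ m) :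
    (ν.real (Set.Ici m) ^ d) ^ T ≤ (walkLaw d ν T).real
      {x | ∀ i j, i ≤ j → √d * m * ((j.val : ℝ) - i.val) ≤ ‖x j - x i‖} := by
  have hbox : MeasurableSet {v : EuclideanSpace ℝ (Fin d) | ∀ l, m ≤ v l} := by
    simp only [Set.ofPred_forall]
    exact .iInter fun l => measurableSet_le measurable_const (by fun_prop)
  have h1 : incrementLaw d ν {v | ∀ l, m ≤ v l} = ν (Set.Ici m) ^ d := by
    rw [incrementLaw, Measure.map_apply (by fun_prop) hbox,
      show WithLp.toLp 2 ⁻¹' {v : EuclideanSpace ℝ (Fin d) | ∀ l, m ≤ v l} =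
        Set.univ.pi fun _ => Set.Ici m by ext; simp [Pi.le_def], Measure.pi_pi]
    simp
  have h2 : (Measure.pi fun _ : Fin T => incrementLaw d ν)
      (Set.univ.pi fun _ => {v | ∀ l, m ≤ v l}) = (ν (Set.Ici m) ^ d) ^ T := by
    rw [Measure.pi_pi]
    simp [h1]
  have h3 : (ν (Set.Ici m) ^ d) ^ T ≤ walkLaw d ν T
      {x | ∀ i j, i ≤ j → √d * m * ((j.val : ℝ) - i.val) ≤ ‖x j - x i‖} := by
    rw [← h2, walkLaw, Measure.map_apply measurable_walkPath (measurableSet_le_norm_sub _)]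
    refine measure_mono fun φ hφ i j hij => le_norm_walkPath_sub hm (fun k l => ?_) hij
    exact hφ k (Set.mem_univ k) l
  have h4 := ENNReal.toReal_mono (measure_ne_top _ _) h3
  simpa [Measure.real] using h4

end Law

/-! ### The constants `alphaStar` and `cCrit` -/

theorem alphaStar_pos {c : ℝ} (hc : 0 < c) (hc' : c < cCrit) : 0 < alphaStar c := by
  have htanh : (0 : ℝ) < 1 + tanh 2 := by linarith [neg_one_lt_tanh 2]
  have h1 : (1 : ℝ) < 2 ^ c := one_lt_rpow (by norm_num) hc
  have h2 : (2 : ℝ) ^ c < 1 + tanh 2 :=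
    (lt_logb_iff_rpow_lt (by norm_num) htanh).1 hc'
  have h3 := tanh_lt_one 2
  exact mul_pos (by positivity) (artanh_pos ⟨by linarith, by linarith⟩)

theorem cCrit_le_one : cCrit ≤ 1 := by
  have htanh : (0 : ℝ) < 1 + tanh 2 := by linarith [neg_one_lt_tanh 2]
  rw [cCrit, logb_le_iff_le_rpow (by norm_num) htanh, rpow_one]
  linarith [tanh_lt_one 2]

/-! ### Integrability and ballisticity -/

section Repulsive

variable {d T : ℕ} {ν : Measure ℝ} [IsProbabilityMeasure ν] {M : ℝ}

theorem integrable_exp_longRangeInteraction_mul {γ : ℝ} (hγ : 0 ≤ γ) (ξ : ℝ) (hM : 0 ≤ M)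
    (hν : ∀ᵐ s ∂ν, |s| ≤ M) {α : ℝ} (hα : 0 ≤ α)
    {g : (Fin (T + 1) → EuclideanSpace ℝ (Fin d)) → ℝ} (hg : Measurable g) {D : ℝ}
    (hgD : ∀ x, x 0 = 0 → (∀ i j, i ≤ j → ‖x j - x i‖ ≤ √d * M * ((j.val : ℝ) - i.val)) →
      ‖g x‖ ≤ D) :
    Integrable (fun x => exp (α * longRangeInteraction γ ξ x) * g x) (walkLaw d ν T) := by
  have hmeas : Measurable fun x : Fin (T + 1) → EuclideanSpace ℝ (Fin d) =>
      exp (α * longRangeInteraction γ ξ x) * g x :=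
    (measurable_exp.comp ((measurable_longRangeInteraction γ ξ).const_mul α)).mul hg
  refine (integrable_const (exp (α * straightEnergy T γ ξ (√d * M)) * D)).mono'
    hmeas.aestronglyMeasurable ?_
  filter_upwards [ae_walkLaw_norm_sub_le hM hν] with x hx
  rw [norm_mul, norm_of_nonneg (exp_pos _).le]
  refine mul_le_mul ?_ (hgD x hx.1 hx.2) (norm_nonneg _) (exp_pos _).le
  exact exp_le_exp.2 (mul_le_mul_of_nonneg_left
    (longRangeInteraction_le_straightEnergy hγ (by positivity) hx.2) hα)

theorem integrable_exp_longRangeInteraction {γ : ℝ} (hγ : 0 ≤ γ) (ξ : ℝ) (hM : 0 ≤ M)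
    (hν : ∀ᵐ s ∂ν, |s| ≤ M) {α : ℝ} (hα : 0 ≤ α) :
    Integrable (fun x => exp (α * longRangeInteraction γ ξ x)) (walkLaw d ν T) := by
  simpa using integrable_exp_longRangeInteraction_mul (d := d) (T := T) hγ ξ hM hν hα
    (measurable_const (a := (1 : ℝ))) (D := 1) (by simp)

theorem integrable_exp_longRangeInteraction_mul_sq_norm {γ : ℝ} (hγ : 0 ≤ γ) (ξ : ℝ) (hM : 0 ≤ M)
    (hν : ∀ᵐ s ∂ν, |s| ≤ M) {α : ℝ} (hα : 0 ≤ α) :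
    Integrable (fun x => exp (α * longRangeInteraction γ ξ x) * ‖x (Fin.last T)‖ ^ 2)
      (walkLaw d ν T) := by
  refine integrable_exp_longRangeInteraction_mul hγ ξ hM hν hα (by fun_prop)
    (D := (√d * M * T) ^ 2) fun x hx0 hx => ?_
  have h := hx 0 (Fin.last T) (Fin.zero_le _)
  simp only [hx0, sub_zero, Fin.val_last, Fin.val_zero, Nat.cast_zero] at h
  rw [norm_pow, norm_norm]
  gcongr

theorem integrable_sq_norm_repulsiveLaw {γ : ℝ} (hγ : 0 ≤ γ) (ξ : ℝ) (hM : 0 ≤ M)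
    (hν : ∀ᵐ s ∂ν, |s| ≤ M) {α : ℝ} (hα : 0 ≤ α) :
    Integrable (fun x => ‖x (Fin.last T)‖ ^ 2) (repulsiveLaw d ν α T γ ξ) := by
  rw [repulsiveLaw, integrable_tilted_iff (integrable_exp_longRangeInteraction hγ ξ hM hν hα)]
  simpa only [smul_eq_mul] using
    integrable_exp_longRangeInteraction_mul_sq_norm hγ ξ hM hν hα

/-- For `γ ≥ 1` and `ξ ≤ γ` the repulsive walk is ballistic, uniformly for `α` bounded below. -/
theorem exists_mul_sq_le_integral_sq_norm (hd : 1 ≤ d) {γ ξ : ℝ} (hγ : 1 ≤ γ) (hβ : 0 ≤ γ - ξ)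
    (hM : 0 < M) (hν : ∀ᵐ s ∂ν, |s| ≤ M) (hpos : ∀ m < M, 0 < ν (Set.Ici m))
    {α₀ : ℝ} (hα₀ : 0 < α₀) :
    ∃ C : ℝ, 0 < C ∧ ∀ α, α₀ ≤ α → ∀ T : ℕ, 1 ≤ T →
      C * (T : ℝ) ^ 2 ≤ ∫ x, ‖x (Fin.last T)‖ ^ 2 ∂(repulsiveLaw d ν α T γ ξ) := by
  set R := √d * M with hR
  have hR0 : 0 < R := mul_pos (sqrt_pos.2 (by exact_mod_cast hd)) hM
  set κ : ℝ := 1 / 3 * (1 / 8 * (1 / 8)) * (3 / 4) ^ (γ - ξ) with hκ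
  have hκ0 : 0 < κ := by positivity
  have hκ1 : κ ≤ 1 := by
    have : (3 / 4 : ℝ) ^ (γ - ξ) ≤ 1 := rpow_le_one (by norm_num) (by norm_num) hβ
    rw [hκ]; linarith
  -- Chosen so that nearly straight paths lose `κ / 2`, half the loss `κ` of paths with a close
  -- endpoint.
  set ε : ℝ := κ / (8 * γ) with hε
  have hε0 : 0 < ε := by positivity
  have hε1 : ε ≤ 1 / 8 := by
    rw [hε, div_le_iff₀ (by positivity)]; linarith
  have hγε : γ * ε * 4 = κ / 2 := by
    rw [hε]; field_simp; norm_num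
  set p := ν.real (Set.Ici ((1 - ε) * M)) ^ d with hp
  have hp0 : 0 < p := by
    refine pow_pos (ENNReal.toReal_pos (hpos _ ?_).ne' (measure_ne_top _ _)) d
    nlinarith
  set a := α₀ * (κ / 2 * R ^ γ) with ha
  have ha0 : 0 < a := by positivity
  -- Completing the square, `-a * T ^ 2 - T * log p` is at most `log p ^ 2 / (4 * a)`, so `K`
  -- depends on neither `α` nor `T`.
  set K := exp (log p ^ 2 / (4 * a)) with hK
  refine ⟨(R / 4) ^ 2 / (1 + K), by positivity, fun α hα T hT => ?_⟩
  have hT' : (1 : ℝ) ≤ T := by exact_mod_cast hT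
  have hα0 : 0 ≤ α := hα₀.le.trans hα
  have hmain := ae_walkLaw_norm_sub_le (d := d) (T := T) hM.le hν
  have hm0 : 0 ≤ (1 - ε) * M := mul_nonneg (by linarith) hM.le
  set E : ℝ := R ^ γ * (T : ℝ) ^ (2 + (γ - ξ)) with hE
  have hb : exp (-(α * (κ / 2 * E))) ≤ K * p ^ T := by
    have hE' : R ^ γ * (T : ℝ) ^ 2 ≤ E := by
      rw [hE, ← rpow_two]
      gcongr
      · linarith
    have h1 : a * (T : ℝ) ^ 2 ≤ α * (κ / 2 * E) := by
      calc a * (T : ℝ) ^ 2 = α₀ * (κ / 2 * (R ^ γ * (T : ℝ) ^ 2)) := by rw [ha]; ring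
        _ ≤ α * (κ / 2 * E) := by gcongr
    have h2 : -(a * (T : ℝ) ^ 2) ≤ log p ^ 2 / (4 * a) + T * log p := by
      have : log p ^ 2 / (4 * a) + T * log p + a * (T : ℝ) ^ 2 =
          (log p + 2 * a * T) ^ 2 / (4 * a) := by
        field_simp; ring
      have : 0 ≤ (log p + 2 * a * T) ^ 2 / (4 * a) := by positivity
      linarith
    calc exp (-(α * (κ / 2 * E))) ≤ exp (log p ^ 2 / (4 * a) + T * log p) :=
          exp_le_exp.2 (by linarith)
      _ = K * p ^ T := by rw [exp_add, exp_nat_mul, exp_log hp0]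
  have hlow := div_one_add_le_integral_tilted (μ := walkLaw d ν T)
    (f := fun x => α * longRangeInteraction γ ξ x) (g := fun x => ‖x (Fin.last T)‖ ^ 2)
    (r := (R * T / 4) ^ 2) (h := α * straightEnergy T γ ξ R) (b := α * (κ / 2 * E)) (K := K)
    (q := p ^ T)
    (G := {x | ∀ i j, i ≤ j → √d * ((1 - ε) * M) * ((j.val : ℝ) - i.val) ≤ ‖x j - x i‖})
    (integrable_exp_longRangeInteraction (by linarith) ξ hM.le hν hα0)
    (integrable_exp_longRangeInteraction_mul_sq_norm (by linarith) ξ hM.le hν hα0)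
    (fun x => by positivity) (by positivity) (exp_pos _).le (measurableSet_le_norm_sub _)
    (pow_le_walkLaw_straight hm0) ?_ ?_ hb
  · refine le_trans (le_of_eq ?_) hlow
    ring
  · filter_upwards [hmain] with x hx hlt
    have hlt' := lt_of_pow_lt_pow_left₀ 2 (by positivity) hlt
    have := le_straightEnergy_sub hγ hβ hR0.le hT hx.2 hx.1 hlt'
    calc α * longRangeInteraction γ ξ x ≤ α * (straightEnergy T γ ξ R - κ * E) := by gcongr
      _ = _ := by ring
  · filter_upwards [hmain] with x hx hxG
    have hxG' : ∀ i j, i ≤ j → (1 - ε) * R * ((j.val : ℝ) - i.val) ≤ ‖x j - x i‖ :=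
      fun i j hij => by
        have := hxG i j hij
        rwa [show √d * ((1 - ε) * M) = (1 - ε) * R by rw [hR]; ring] at this
    constructor
    · have h := hxG' 0 (Fin.last T) (Fin.zero_le _)
      simp only [hx.1, sub_zero, Fin.val_last, Fin.val_zero, Nat.cast_zero] at h
      have : R * T / 4 ≤ (1 - ε) * R * T := by
        have : 0 ≤ R * T := by positivity
        nlinarith
      have := this.trans h
      gcongr
    · have := straightEnergy_sub_le hγ hβ hR0.le hε0.le (by linarith) hT
        (fun i j hij => hxG' i j hij.le)
      rw [hγε] at this
      calc α * straightEnergy T γ ξ R - α * (κ / 2 * E)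
          = α * (straightEnergy T γ ξ R - κ / 2 * E) := by ring
        _ ≤ _ := by gcongr

end Repulsive

theorem theorem2 (d : ℕ) (hd : 1 ≤ d)
    (ν : Measure ℝ) [IsProbabilityMeasure ν]
    (hsymm : ν.map (fun s : ℝ => -s) = ν)
    (hcompact : IsCompact ν.support)
    (hnontrivial : ν ≠ Measure.dirac 0)
    (γ : ℕ) (hγ_pos : 0 < γ) (hγ_even : Even γ)
    (c : ℝ) (hc_pos : 0 < c) (hc_lt : c < cCrit) :
    ∃ C : ℝ, 0 < C ∧ ∀ α : ℝ, alphaStar c ≤ α → ∀ T : ℕ,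
      Integrable (fun x => ‖x (Fin.last T)‖ ^ 2)
        (repulsiveLaw d ν α T (γ : ℝ) ((γ : ℝ) / 2 + c)) ∧
      C * (T : ℝ) ^ (1 + Real.logb 2 (1 + Real.tanh 2)) ≤
        ∫ x, ‖x (Fin.last T)‖ ^ 2
          ∂(repulsiveLaw d ν α T (γ : ℝ) ((γ : ℝ) / 2 + c)) := by
  obtain ⟨M, hM, hνM, hpos⟩ := exists_essSup_abs_of_symmetric hsymm hcompact hnontrivial
  have hcrit := cCrit_le_one
  have hα₀ := alphaStar_pos hc_pos hc_lt
  have hγ2 : (2 : ℝ) ≤ γ := by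
    obtain ⟨k, rfl⟩ := hγ_even
    exact_mod_cast (by omega : 2 ≤ k + k)
  obtain ⟨C, hC, hbound⟩ := exists_mul_sq_le_integral_sq_norm (ν := ν) hd
    (γ := (γ : ℝ)) (ξ := (γ : ℝ) / 2 + c) (by linarith) (by linarith) hM hνM hpos hα₀
  refine ⟨C, hC, fun α hα T => ⟨integrable_sq_norm_repulsiveLaw (by linarith) _ hM.le hνM
    (hα₀.le.trans hα), ?_⟩⟩
  change C * (T : ℝ) ^ (1 + cCrit) ≤ _
  rcases Nat.eq_zero_or_pos T with rfl | hT
  · rw [Nat.cast_zero, zero_rpow (by linarith), mul_zero]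
    exact integral_nonneg fun x => by positivity
  · refine le_trans ?_ (hbound α hα T hT)
    -- For `1 ≤ T` the quadratic bound dominates, as `1 + cCrit ≤ 2`.
    rw [← rpow_two]
    gcongr
    · exact_mod_cast hT
    · linarith
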